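/- Let $\mathcal H\neq\{0\}$ be a complex Hilbert space and let $T_1,T_2$ be commuting bounded operators on $\mathcal H$, each of which is a pure contraction, i.e. $\|T_i\|\le 1$ and $\|T_i^{*m}h\|\to 0$ as $m\to\infty$ for every $h\in\mathcal H$. Put $D_{T_i^*}=(I-T_iT_i^*)^{1/2}$ and $\mathcal D_{T_i^*}=\overline{D_{T_i^*}\mathcal H}$, and assume that $\dim\mathcal D_{T_i^*}<\infty$ for $i=1,2$. Let $P$ be the orthogonal projection of $\mathcal D_{T_1^*}\oplus\mathcal D_{T_2^*}$ onto its second component and $P^\perp=I-P$. Then there is a unitary $U$ on $\mathcal D_{T_1^*}\oplus\mathcal D_{T_2^*}$ with $$U(D_{T_1^*}T_2^*h,\;D_{T_2^*}h)=(D_{T_1^*}h,\;D_{T_2^*}T_1^*h)\qquad(h\in\mathcal H)$$ such that, with $\Phi(z)=(P+zP^\perp)U^*$ and $\Psi(z)=U(P^\perp+zP)$, the set $$\tilde{\mathcal V}_{U,P}=\{(z_1,z_2)\in\mathbb D^2:\ \det(\Phi(z_1z_2)-z_1I)=0\ \text{ and }\ \det(\Psi(z_1z_2)-z_2I)=0\}$$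 is an algebraic distinguished variety, that is, it is non-empty, it is the common zero set in $\mathbb D^2$ of finitely many polynomials, and $\overline{\tilde{\mathcal V}_{U,P}}\cap\partial(\mathbb D^2)=\overline{\tilde{\mathcal V}_{U,P}}\cap\mathbb T^2$; and $$\|p(T_1,T_2)\|\le\sup_{(z_1,z_2)\in\tilde{\mathcal V}_{U,P}}|p(z_1,z_2)|\qquad(p\in\mathbb C[z_1,z_2]).$$ Moreover, $\tilde{\mathcal V}_{U,P}=\mathcal W\cup\{(0,0)\}$ for a distinguished variety $\mathcal W$ in the sense of Agler and McCarthy (a non-empty zero set in $\mathbb D^2$ of a single polynomial, with $\overline{\mathcal W}\cap\partial(\mathbb D^2)=\overline{\mathcal W}\cap\mathbb T^2$), and $\|p(T_1,T_2)\|\le\sup_{\mathcal W}|p|$ for every $p\in\mathbb C[z_1,z_2]$. -/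

import Mathlib

namespace BCL

open Filter Topology ContinuousLinearMap

noncomputable section

section Operators

variable {H : Type*} [NormedAddCommGroup H] [InnerProductSpace ℂ H] [CompleteSpace H]

/-- A pure contraction: `‖T‖ ≤ 1` and `T*ᵐ → 0` in the strong operator topology. -/
structure IsPureContraction (T : H →L[ℂ] H) : Prop where
  norm_le_one : ‖T‖ ≤ 1
  tendsto_zero : ∀ h : H, Tendsto (fun m : ℕ => (adjoint T ^ m) h) atTop (𝓝 0)

/-- The defect operator `D_{T*} = (I - T T*)^{1/2}`: the positive square root, given by the
continuous functional calculus. -/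
def defectOp (T : H →L[ℂ] H) : H →L[ℂ] H :=
  CFC.sqrt (1 - T * adjoint T)

/-- The defect space `𝒟_{T*}`: the closure of the range of `D_{T*}`. -/
def defectSpace (T : H →L[ℂ] H) : Submodule ℂ H :=
  (LinearMap.range (defectOp T).toLinearMap).topologicalClosure

/-- `D_{T*} h`, regarded as an element of the defect space `𝒟_{T*}`. -/
def defectVec (T : H →L[ℂ] H) (h : H) : defectSpace T :=
  ⟨defectOp T h, Submodule.le_topologicalClosure _ ⟨h, rfl⟩⟩

/-- The Hilbert space orthogonal direct sum `𝒟_{T₁*} ⊕ 𝒟_{T₂*}`. -/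
abbrev DefectSum (T₁ T₂ : H →L[ℂ] H) : Type _ :=
  WithLp 2 (defectSpace T₁ × defectSpace T₂)

/-- The orthogonal projection `P (h₁, h₂) = (0, h₂)` of `𝒟_{T₁*} ⊕ 𝒟_{T₂*}` onto its second
component. -/
def sndProj (T₁ T₂ : H →L[ℂ] H) : DefectSum T₁ T₂ →ₗ[ℂ] DefectSum T₁ T₂ where
  toFun x := WithLp.toLp 2 (0, x.snd)
  map_add' x y := by
    apply (WithLp.ofLp_injective 2); simp
  map_smul' c x := by
    apply (WithLp.ofLp_injective 2); simp

/-- The unitary `U` on `𝒟_{T₁*} ⊕ 𝒟_{T₂*}` extends the isometry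
`(D_{T₁*} T₂* h, D_{T₂*} h) ↦ (D_{T₁*} h, D_{T₂*} T₁* h)`. -/
def IsCanonicalUnitary (T₁ T₂ : H →L[ℂ] H)
    (U : DefectSum T₁ T₂ ≃ₗᵢ[ℂ] DefectSum T₁ T₂) : Prop :=
  ∀ h : H,
    U (WithLp.toLp 2 (defectVec T₁ (adjoint T₂ h), defectVec T₂ h)) =
      WithLp.toLp 2 (defectVec T₁ h, defectVec T₂ (adjoint T₁ h))

/-- `p(T₁, T₂) = ∑ c_{jk} T₁ʲ T₂ᵏ` for a polynomial `p = ∑ c_{jk} z₁ʲ z₂ᵏ` (the two operators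
are meant to commute). -/
def polyEval (p : MvPolynomial (Fin 2) ℂ) (T₁ T₂ : H →L[ℂ] H) : H →L[ℂ] H :=
  ∑ m ∈ p.support, p.coeff m • (T₁ ^ m 0 * T₂ ^ m 1)

end Operators

section Symbols

variable {E : Type*} [NormedAddCommGroup E] [InnerProductSpace ℂ E]

/-- `Φ(z) = (P + z P^⊥) U*`, where `P^⊥ = I - P`; the adjoint of the unitary `U` is its
inverse. -/
def symbolPhi (U : E ≃ₗᵢ[ℂ] E) (P : E →ₗ[ℂ] E) (z : ℂ) : E →ₗ[ℂ] E :=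
  (P + z • (LinearMap.id - P)) ∘ₗ U.symm.toLinearEquiv.toLinearMap

/-- `Ψ(z) = U (P^⊥ + z P)`, where `P^⊥ = I - P`. -/
def symbolPsi (U : E ≃ₗᵢ[ℂ] E) (P : E →ₗ[ℂ] E) (z : ℂ) : E →ₗ[ℂ] E :=
  U.toLinearEquiv.toLinearMap ∘ₗ ((LinearMap.id - P) + z • P)

end Symbols

/-- The open unit bidisc `𝔻²`. -/
def bidisc : Set (ℂ × ℂ) := {z | ‖z.1‖ < 1 ∧ ‖z.2‖ < 1}

/-- The torus `𝕋²`, the distinguished boundary of the bidisc. -/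
def torus : Set (ℂ × ℂ) := {z | ‖z.1‖ = 1 ∧ ‖z.2‖ = 1}

/-- The value of the polynomial `p` at `z = (z₁, z₂)`. -/
def evalAt (p : MvPolynomial (Fin 2) ℂ) (z : ℂ × ℂ) : ℂ :=
  MvPolynomial.eval ![z.1, z.2] p

/-- `{(z₁, z₂) ∈ 𝔻² : det (Φ(z₁ z₂) - z₁ I) = 0 and det (Ψ(z₁ z₂) - z₂ I) = 0}`, for a unitary
`U` and a projection `P` on a finite-dimensional space `E`. -/
def bclVariety {E : Type*} [NormedAddCommGroup E] [InnerProductSpace ℂ E]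
    (U : E ≃ₗᵢ[ℂ] E) (P : E →ₗ[ℂ] E) : Set (ℂ × ℂ) :=
  {z | z ∈ bidisc ∧
    LinearMap.det (symbolPhi U P (z.1 * z.2) - z.1 • LinearMap.id) = 0 ∧
    LinearMap.det (symbolPsi U P (z.1 * z.2) - z.2 • LinearMap.id) = 0}

/-- `V` meets the boundary of the bidisc only in the torus:
`closure V ∩ ∂(𝔻²) = closure V ∩ 𝕋²`. -/
def ExitsThroughTorus (V : Set (ℂ × ℂ)) : Prop :=
  closure V ∩ frontier bidisc = closure V ∩ torus

/-- An algebraic distinguished variety in `𝔻²`: a non-empty common zero set in `𝔻²` of finitely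
many polynomials that exits the bidisc through the torus. -/
def IsAlgebraicDistinguishedVariety (V : Set (ℂ × ℂ)) : Prop :=
  V.Nonempty ∧
    (∃ S : Finset (MvPolynomial (Fin 2) ℂ),
      V = {z | z ∈ bidisc ∧ ∀ q ∈ S, evalAt q z = 0}) ∧
    ExitsThroughTorus V

/-- A distinguished variety in the sense of Agler and McCarthy: a non-empty zero set in `𝔻²` of a
single polynomial that exits the bidisc through the torus. -/
def IsDistinguishedVariety (V : Set (ℂ × ℂ)) : Prop :=
  V.Nonempty ∧
    (∃ q : MvPolynomial (Fin 2) ℂ, V = {z | z ∈ bidisc ∧ evalAt q z = 0}) ∧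
    ExitsThroughTorus V

end

end BCL

/-! ### Topology of the bidisc and the exit condition -/

namespace BCL

open Filter Topology ContinuousLinearMap

/-! Put `T = T₁ T₂` and `B h = (D_{T₁*} h, D_{T₂*} T₁* h)`. Since `‖T₁‖, ‖T₂‖ ≤ 1`, the vectors
`(D_{T₁*} T₂* h, D_{T₂*} h)` and `B h` have the same norm `(‖h‖² - ‖T* h‖²)^{1/2}`, so in finite
dimension the map between them extends to a unitary `U`. Then `B* B = I - T T*`, and purity makes `h
↦ ∑ zⁿ B T*ⁿ h` an isometry; its adjoint intertwines multiplication by `Φ`, `Ψ` with `T₁`, `T₂`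
(`IsCanonicalUnitary.isModelMap`). Hence `‖p(T₁, T₂)‖ ≤ sup_{|z| = 1} ‖p(Φ(z), Ψ(z))‖`
(`IsModelMap.norm_polyEval_le`).

For `|z| = 1` the matrices `Φ(z)`, `Ψ(z)` are commuting unitaries with product `z`, so `p(Φ(z),
Ψ(z))` is normal and its norm is `|p(c, z/c)|` at some joint eigenvalue. Such a point is a limit of
points of the variety, because the eigenvalues of `Φ(rz)` tend to those of `Φ(z)` as `r → 1`
(`IsNondegenerate.mem_closure_reducedVariety`).

For the geometry, purity forbids eigenvectors of `U` in the range or kernel of `P`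
(`IsCanonicalUnitary.isNondegenerate`). This puts the eigenvalues of `Φ(z)` and `Ψ(z)`, `|z| < 1`,
strictly inside the disc, which is the exit condition. Away from the origin, both determinant
conditions amount to solving `(P + z₂ P^⊥) v = (P^⊥ + z₁ P) U v` with `v ≠ 0`, the vanishing of one
determinant; this is `W`. -/

lemma continuous_evalAt (p : MvPolynomial (Fin 2) ℂ) : Continuous (evalAt p) := by
  unfold evalAt
  refine p.continuous_eval.comp (continuous_pi fun i => ?_)
  fin_cases i
  · exact continuous_fst
  · exact continuous_snd

lemma bddAbove_evalAt_image (p : MvPolynomial (Fin 2) ℂ) {V : Set (ℂ × ℂ)} (hV : V ⊆ bidisc) :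
    BddAbove ((fun z => ‖evalAt p z‖) '' V) := by
  have hc : IsCompact (Metric.closedBall (0 : ℂ × ℂ) 1) := isCompact_closedBall 0 1
  refine (hc.bddAbove_image (continuous_evalAt p).norm.continuousOn).mono
    (Set.image_mono fun z hz => ?_)
  rw [mem_closedBall_zero_iff, Prod.norm_def]
  exact max_le (hV hz).1.le (hV hz).2.le

lemma closure_bidisc_subset : closure bidisc ⊆ {z : ℂ × ℂ | ‖z.1‖ ≤ 1 ∧ ‖z.2‖ ≤ 1} := by
  refine closure_minimal (fun z hz => ⟨hz.1.le, hz.2.le⟩) ?_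
  exact (isClosed_le continuous_fst.norm continuous_const).inter
    (isClosed_le continuous_snd.norm continuous_const)

lemma isOpen_bidisc : IsOpen bidisc :=
  (isOpen_lt continuous_fst.norm continuous_const).inter
    (isOpen_lt continuous_snd.norm continuous_const)

lemma ExitsThroughTorus.of_forall {V : Set (ℂ × ℂ)} (hV : V ⊆ bidisc)
    (h₁ : ∀ z ∈ closure V, ‖z.1‖ = 1 → ¬ ‖z.2‖ < 1)
    (h₂ : ∀ z ∈ closure V, ‖z.2‖ = 1 → ¬ ‖z.1‖ < 1) : ExitsThroughTorus V := by
  unfold ExitsThroughTorus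
  ext z
  simp only [Set.mem_inter_iff, isOpen_bidisc.frontier_eq, Set.mem_sdiff]
  refine and_congr_right fun hz => ⟨fun ⟨h, hn⟩ => ?_, fun h => ⟨closure_mono hV hz, fun hn => ?_⟩⟩
  · obtain ⟨ha, hb⟩ := closure_bidisc_subset h
    have h1 := h₁ z hz
    have h2 := h₂ z hz
    have hn' : ¬ (‖z.1‖ < 1 ∧ ‖z.2‖ < 1) := hn
    show ‖z.1‖ = 1 ∧ ‖z.2‖ = 1
    rcases ha.lt_or_eq with h3 | h3 <;> rcases hb.lt_or_eq with h4 | h4 <;> tauto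
  · exact absurd h.1 hn.1.ne

/-- The exit condition is pointwise on the closure, so it passes to subsets. -/
lemma ExitsThroughTorus.mono {V W : Set (ℂ × ℂ)} (hV : ExitsThroughTorus V) (hWV : W ⊆ V) :
    ExitsThroughTorus W := by
  unfold ExitsThroughTorus at *
  ext z
  have := Set.ext_iff.1 hV z
  simp only [Set.mem_inter_iff] at *
  refine and_congr_right fun hz => ?_
  have hz' := closure_mono hWV hz
  tauto

/-! ### Determinants of two-variable operator pencils -/

section Pencil

variable {E : Type*} [AddCommGroup E] [Module ℂ E] [FiniteDimensional ℂ E]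

lemma exists_mvPolynomial_evalAt_eq_det (A B C D : E →ₗ[ℂ] E) :
    ∃ q : MvPolynomial (Fin 2) ℂ, ∀ z : ℂ × ℂ,
      evalAt q z = LinearMap.det (A + z.1 • B + z.2 • C + (z.1 * z.2) • D) := by
  let b := Module.finBasis ℂ E
  let X : Fin 2 → MvPolynomial (Fin 2) ℂ := MvPolynomial.X
  let c (F : E →ₗ[ℂ] E) := (LinearMap.toMatrix b b F).map (MvPolynomial.C (σ := Fin 2))
  refine ⟨(c A + X 0 • c B + X 1 • c C + (X 0 * X 1) • c D).det, fun z => ?_⟩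
  rw [evalAt, RingHom.map_det, ← LinearMap.det_toMatrix b]
  congr 1
  ext i j
  simp [c, X]

lemma det_eq_zero_iff_exists {F : E →ₗ[ℂ] E} :
    LinearMap.det F = 0 ↔ ∃ v, v ≠ 0 ∧ F v = 0 := by
  rw [LinearMap.det_eq_zero_iff_ker_ne_bot, Submodule.ne_bot_iff]
  simp only [LinearMap.mem_ker]
  exact exists_congr fun v => and_comm

end Pencil

/-! ### Nondegenerate projections and the single-determinant variety -/

section Variety

variable {E : Type*} [NormedAddCommGroup E] [InnerProductSpace ℂ E]

/-- A symmetric projection `P` is *nondegenerate* for `U` when it is neither `0` nor `I` and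
neither its range nor its kernel contains an eigenvector of `U`. -/
structure IsNondegenerate (U : E ≃ₗᵢ[ℂ] E) (P : E →ₗ[ℂ] E) : Prop where
  isSymmetricProjection : P.IsSymmetricProjection
  exists_apply_eq_zero : ∃ v, v ≠ 0 ∧ P v = 0
  exists_apply_eq_self : ∃ v, v ≠ 0 ∧ P v = v
  eq_zero_of_mem_range : ∀ v, ∀ c : ℂ, P v = v → U v = c • v → v = 0
  eq_zero_of_mem_ker : ∀ v, ∀ c : ℂ, P v = 0 → U v = c • v → v = 0

/-- The zero set in the bidisc of `det (z₂ P^⊥ + P - (P^⊥ + z₁ P) U)`. -/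
def reducedVariety (U : E ≃ₗᵢ[ℂ] E) (P : E →ₗ[ℂ] E) : Set (ℂ × ℂ) :=
  {z | z ∈ bidisc ∧ LinearMap.det ((P - (LinearMap.id - P) ∘ₗ U.toLinearEquiv.toLinearMap)
    + z.1 • (-(P ∘ₗ U.toLinearEquiv.toLinearMap)) + z.2 • (LinearMap.id - P)
    + (z.1 * z.2) • (0 : E →ₗ[ℂ] E)) = 0}

lemma symbolPhi_apply (U : E ≃ₗᵢ[ℂ] E) (P : E →ₗ[ℂ] E) (z : ℂ) (v : E) :
    symbolPhi U P z v = P (U.symm v) + z • (U.symm v - P (U.symm v)) := by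
  simp [symbolPhi]

lemma symbolPsi_apply (U : E ≃ₗᵢ[ℂ] E) (P : E →ₗ[ℂ] E) (z : ℂ) (v : E) :
    symbolPsi U P z v = U ((v - P v) + z • P v) := by
  simp [symbolPsi]

lemma norm_sq_add_smul {P : E →ₗ[ℂ] E} (hP : P.IsSymmetricProjection) (a b : ℂ) (x : E) :
    ‖a • P x + b • (x - P x)‖ ^ 2 = ‖a‖ ^ 2 * ‖P x‖ ^ 2 + ‖b‖ ^ 2 * ‖x - P x‖ ^ 2 := by
  have hPP : P (P x) = P x := congrArg (· x) hP.1
  have h0 : inner ℂ (a • P x) (b • (x - P x)) = 0 := by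
    rw [inner_smul_left, inner_smul_right, hP.2 x, map_sub, hPP, sub_self]
    simp
  have := norm_add_sq_eq_norm_sq_add_norm_sq_of_inner_eq_zero _ _ h0
  rw [sq, this, norm_smul, norm_smul]
  ring

lemma norm_sq_eq_add {P : E →ₗ[ℂ] E} (hP : P.IsSymmetricProjection) (x : E) :
    ‖x‖ ^ 2 = ‖P x‖ ^ 2 + ‖x - P x‖ ^ 2 := by
  simpa using norm_sq_add_smul hP 1 1 x

variable {U : E ≃ₗᵢ[ℂ] E} {P : E →ₗ[ℂ] E}

/-- With `w = U* v`, `‖Φ(z) v‖² = ‖P w‖² + |z|² ‖P^⊥ w‖²`. If `|c| ≥ 1`, this forces `P^⊥ w = 0`,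
and then `w` is an eigenvector of `U` in the range of `P`. -/
lemma IsNondegenerate.norm_lt_one_of_symbolPhi (h : IsNondegenerate U P) {z c : ℂ} (hz : ‖z‖ < 1)
    {v : E} (hv : v ≠ 0) (hc : symbolPhi U P z v = c • v) : ‖c‖ < 1 := by
  by_contra! hc1
  set w := U.symm v with hw
  have hvw : v = U w := by simp [hw]
  have e1 := norm_sq_add_smul h.1 1 z w
  have e2 := norm_sq_eq_add h.1 w
  rw [symbolPhi_apply, ← hw] at hc
  have e3 : ‖v‖ = ‖w‖ := by rw [hvw, U.norm_map]
  rw [one_smul, hc, norm_smul, e3, norm_one, one_pow, one_mul, mul_pow] at e1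
  have hz2 : ‖z‖ ^ 2 < 1 := by nlinarith [norm_nonneg z]
  have hc2 : 1 ≤ ‖c‖ ^ 2 := by nlinarith
  have e4 : ‖w - P w‖ ^ 2 = 0 := by nlinarith [sq_nonneg ‖w - P w‖, sq_nonneg ‖w‖]
  have e5 : w - P w = 0 := by simpa using e4
  rw [e5, smul_zero, add_zero] at hc
  have hPw : P w = w := (sub_eq_zero.1 e5).symm
  have hc0 : c ≠ 0 := by rintro rfl; simp at hc1; linarith
  refine hv ?_
  rw [hvw, h.eq_zero_of_mem_range w c⁻¹ hPw, map_zero]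
  rw [← hvw, eq_inv_smul_iff₀ hc0, ← hc, hPw]

lemma IsNondegenerate.norm_lt_one_of_symbolPsi (h : IsNondegenerate U P) {z c : ℂ} (hz : ‖z‖ < 1)
    {v : E} (hv : v ≠ 0) (hc : symbolPsi U P z v = c • v) : ‖c‖ < 1 := by
  by_contra! hc1
  have e1 := norm_sq_add_smul h.1 z 1 v
  have e2 := norm_sq_eq_add h.1 v
  rw [symbolPsi_apply] at hc
  rw [one_smul, add_comm (z • P v), ← U.norm_map, hc, norm_smul, norm_one, one_pow, one_mul,
    mul_pow] at e1
  have hz2 : ‖z‖ ^ 2 < 1 := by nlinarith [norm_nonneg z]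
  have hc2 : 1 ≤ ‖c‖ ^ 2 := by nlinarith
  have e4 : ‖P v‖ ^ 2 = 0 := by nlinarith [sq_nonneg ‖P v‖, sq_nonneg ‖v‖]
  have e5 : P v = 0 := by simpa using e4
  rw [e5, smul_zero, add_zero, sub_zero] at hc
  exact hv (h.eq_zero_of_mem_ker v c e5 hc)

variable [FiniteDimensional ℂ E]

lemma mem_reducedVariety_iff {z : ℂ × ℂ} : z ∈ reducedVariety U P ↔
    z ∈ bidisc ∧ ∃ v, v ≠ 0 ∧ P v + z.2 • (v - P v) = U v - P (U v) + z.1 • P (U v) := by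
  refine and_congr_right fun _ => ?_
  rw [det_eq_zero_iff_exists]
  refine exists_congr fun v => and_congr_right fun _ => ?_
  rw [← sub_eq_zero (b := _ + _)]
  refine Eq.congr ?_ rfl
  simp
  abel

/-- Applying `P` and `P^⊥` splits the pencil equation into its two components. -/
lemma reducedVariety_iff_eqs (hP : P.IsSymmetricProjection) {z : ℂ × ℂ} :
    z ∈ reducedVariety U P ↔ z ∈ bidisc ∧
      ∃ v, v ≠ 0 ∧ P v = z.1 • P (U v) ∧ z.2 • (v - P v) = U v - P (U v) := by
  rw [mem_reducedVariety_iff]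
  refine and_congr_right fun _ => exists_congr fun v => and_congr_right fun _ =>
    ⟨fun h => ?_, fun h => by rw [h.2, h.1, add_comm]⟩
  have hPP (x : E) : P (P x) = P x := congrArg (· x) hP.1
  have h1 := congrArg P h
  simp only [map_add, map_smul, map_sub, hPP, sub_self, smul_zero, add_zero, zero_add] at h1
  refine ⟨h1, ?_⟩
  rw [← h1, add_comm] at h
  exact add_right_cancel h

lemma mem_bclVariety_iff {z : ℂ × ℂ} : z ∈ bclVariety U P ↔ z ∈ bidisc ∧
    (∃ v, v ≠ 0 ∧ symbolPhi U P (z.1 * z.2) v = z.1 • v) ∧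
    ∃ v, v ≠ 0 ∧ symbolPsi U P (z.1 * z.2) v = z.2 • v := by
  refine and_congr_right fun _ => ?_
  rw [det_eq_zero_iff_exists, det_eq_zero_iff_exists]
  simp [sub_eq_zero]

/-- `Φ(0) = P U*` and `Ψ(0) = U P^⊥` are singular because `P` has nonzero kernel and nonzero range.
-/
lemma IsNondegenerate.zero_mem_bclVariety (h : IsNondegenerate U P) :
    ((0, 0) : ℂ × ℂ) ∈ bclVariety U P := by
  rw [mem_bclVariety_iff]
  obtain ⟨v, hv, hPv⟩ := h.exists_apply_eq_zero
  obtain ⟨w, hw, hPw⟩ := h.exists_apply_eq_self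
  refine ⟨by simp [bidisc], ⟨U v, by simpa using hv, ?_⟩, ⟨w, hw, ?_⟩⟩
  · simp [symbolPhi_apply, hPv]
  · simp [symbolPsi_apply, hPw]

lemma IsNondegenerate.reducedVariety_subset (h : IsNondegenerate U P) :
    reducedVariety U P ⊆ bclVariety U P := by
  rintro ⟨z₁, z₂⟩ hz
  obtain ⟨hb, v, hv, h1, h2⟩ := (reducedVariety_iff_eqs h.1).1 hz
  simp only at h1 h2
  rw [mem_bclVariety_iff]
  refine ⟨hb, ⟨U v, by simpa using hv, ?_⟩, ?_⟩
  · simp only [symbolPhi_apply, LinearIsometryEquiv.symm_apply_apply]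
    rw [mul_smul, h2, h1, ← smul_add]
    simp
  · by_cases hz2 : z₂ = 0
    · obtain ⟨w, hw, hPw⟩ := h.exists_apply_eq_self
      exact ⟨w, hw, by simp [symbolPsi_apply, hPw, hz2]⟩
    · refine ⟨U v, by simpa using hv, ?_⟩
      simp only [symbolPsi_apply]
      rw [← map_smul U, ← h2, mul_comm z₁, mul_smul, ← h1, ← smul_add]
      simp

/-- Off the origin one coordinate is nonzero and can be cancelled: an eigenvector of `Φ` solves the
pencil if `z₁ ≠ 0`, one of `Ψ` if `z₂ ≠ 0`. -/
lemma IsNondegenerate.bclVariety_eq (h : IsNondegenerate U P) :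
    bclVariety U P = reducedVariety U P ∪ {(0, 0)} := by
  refine Set.Subset.antisymm ?_ (Set.union_subset h.reducedVariety_subset
    (Set.singleton_subset_iff.2 h.zero_mem_bclVariety))
  rintro ⟨z₁, z₂⟩ hz
  have hPP (x : E) : P (P x) = P x := congrArg (· x) h.1.1
  obtain ⟨hb, ⟨v, hv, hv'⟩, ⟨w, hw, hw'⟩⟩ := mem_bclVariety_iff.1 hz
  simp only at hv' hw'
  rw [Set.mem_union, Set.mem_singleton_iff, reducedVariety_iff_eqs h.1]
  by_cases hz1 : z₁ = 0
  · by_cases hz2 : z₂ = 0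
    · exact Or.inr (by rw [hz1, hz2])
    -- This vector is `z₂ U* w`, by the eigenvalue equation for `Ψ`.
    refine Or.inl ⟨hb, (w - P w) + (z₁ * z₂) • P w, fun h0 => ?_, ?_⟩
    · rw [symbolPsi_apply, h0, map_zero] at hw'
      exact hw ((smul_eq_zero.1 hw'.symm).resolve_left hz2)
    · rw [symbolPsi_apply] at hw'
      rw [hw']
      simp [hPP, smul_sub, mul_smul]
  · refine Or.inl ⟨hb, U.symm v, by simpa using hv, ?_⟩
    rw [symbolPhi_apply] at hv'
    simp only [LinearIsometryEquiv.apply_symm_apply]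
    have h1 := congrArg P hv'
    simp only [map_add, map_smul, map_sub, hPP, sub_self, smul_zero, add_zero] at h1
    refine ⟨h1, ?_⟩
    rw [h1, mul_smul, ← smul_add] at hv'
    have := smul_right_injective E hz1 hv'
    rw [h1]
    exact eq_sub_of_add_eq' this

end Variety

/-! ### Polynomials in two algebra elements -/

section PolySum

variable {A : Type*} [Ring A] [Algebra ℂ A]

/-- `∑ c_{jk} aʲ bᵏ` for a polynomial `p = ∑ c_{jk} z₁ʲ z₂ᵏ` and elements `a, b` of an algebra. -/
noncomputable def polySum (p : MvPolynomial (Fin 2) ℂ) (a b : A) : A :=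
  ∑ m ∈ p.support, p.coeff m • (a ^ m 0 * b ^ m 1)

lemma commute_polySum (p : MvPolynomial (Fin 2) ℂ) {a b x : A} (ha : Commute x a)
    (hb : Commute x b) : Commute x (polySum p a b) :=
  Commute.sum_right _ _ _ fun m _ =>
    ((ha.pow_right (m 0)).mul_right (hb.pow_right (m 1))).smul_right _

lemma map_polySum {B F : Type*} [Ring B] [Algebra ℂ B] [FunLike F A B] [AlgHomClass F ℂ A B]
    (f : F) (p : MvPolynomial (Fin 2) ℂ) (a b : A) :
    f (polySum p a b) = polySum p (f a) (f b) := by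
  simp [polySum, map_sum, map_smul]

lemma polySum_apply_of_eigenvector {E : Type*} [AddCommGroup E] [Module ℂ E]
    (p : MvPolynomial (Fin 2) ℂ) {a b : Module.End ℂ E} {c d : ℂ} {v : E} (ha : a v = c • v)
    (hb : b v = d • v) : polySum p a b v = evalAt p (c, d) • v := by
  have key {f : Module.End ℂ E} {t : ℂ} (h : f v = t • v) (n : ℕ) : (f ^ n) v = t ^ n • v := by
    induction n with
    | zero => simp
    | succ n ih => rw [pow_succ', Module.End.mul_apply, ih, map_smul, h, smul_smul, pow_succ]
  simp only [polySum, evalAt, MvPolynomial.eval_eq', LinearMap.sum_apply, LinearMap.smul_apply,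
    Module.End.mul_apply, key hb, map_smul, key ha, Finset.sum_smul, Fin.prod_univ_two, smul_smul]
  refine Finset.sum_congr rfl fun m _ => ?_
  simp [mul_comm]

end PolySum

/-! ### Roots near a point where a monic polynomial is small -/

section Roots

/-- `|g(x)|` is the product of the distances from `x` to the roots, hence at least the smallest
distance to the power of the degree. This gives continuity of eigenvalues. -/
lemma exists_root_norm_sub_pow_le {g : Polynomial ℂ} (hg : g.Monic) (hd : 0 < g.natDegree)
    (x : ℂ) : ∃ b ∈ g.roots, ‖x - b‖ ^ g.natDegree ≤ ‖g.eval x‖ := by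
  have hs : g.Splits := IsAlgClosed.splits g
  have hcard := hs.natDegree_eq_card_roots
  have hne : g.roots.toFinset.Nonempty := by
    rw [Multiset.toFinset_nonempty, ← Multiset.card_pos]
    omega
  obtain ⟨b, hb, hmin⟩ := g.roots.toFinset.exists_min_image (fun b => ‖x - b‖) hne
  rw [Multiset.mem_toFinset] at hb
  refine ⟨b, hb, ?_⟩
  have h := Multiset.prod_map_le_prod_map₀ (s := g.roots) (fun _ => ‖x - b‖) (fun c => ‖x - c‖)
    (fun _ _ => norm_nonneg _) (fun c hc => hmin c (Multiset.mem_toFinset.2 hc))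
  rw [Multiset.map_const', Multiset.prod_replicate, ← hcard] at h
  refine h.trans_eq ?_
  rw [hs.eval_eq_prod_roots_of_monic hg]
  exact g.roots.prod_hom' (NormedField.toMulRingNorm ℂ) (fun c : ℂ => x - c)

end Roots

/-! ### Exit through the torus and the norm on the unit circle -/

section Variety

variable {E : Type*} [NormedAddCommGroup E] [InnerProductSpace ℂ E]
  {U : E ≃ₗᵢ[ℂ] E} {P : E →ₗ[ℂ] E}

lemma symbolPsi_symbolPhi (hP : P.IsSymmetricProjection) (z : ℂ) (v : E) :
    symbolPsi U P z (symbolPhi U P z v) = z • v := by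
  have hPP (x : E) : P (P x) = P x := congrArg (· x) hP.1
  rw [symbolPsi_apply, symbolPhi_apply]
  have : P (U.symm v) + z • (U.symm v - P (U.symm v)) - P (P (U.symm v) +
      z • (U.symm v - P (U.symm v))) + z • P (P (U.symm v) + z • (U.symm v - P (U.symm v)))
      = z • U.symm v := by
    simp [hPP, smul_sub]
  rw [this]
  simp

lemma symbolPhi_symbolPsi (hP : P.IsSymmetricProjection) (z : ℂ) (v : E) :
    symbolPhi U P z (symbolPsi U P z v) = z • v := by
  have hPP (x : E) : P (P x) = P x := congrArg (· x) hP.1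
  rw [symbolPsi_apply, symbolPhi_apply]
  simp [hPP, smul_sub]

lemma norm_symbolPhi_apply (hP : P.IsSymmetricProjection) {z : ℂ} (hz : ‖z‖ = 1) (v : E) :
    ‖symbolPhi U P z v‖ = ‖v‖ := by
  have h1 := norm_sq_add_smul hP 1 z (U.symm v)
  rw [hz, norm_one, one_pow, one_mul, one_mul, ← norm_sq_eq_add hP, one_smul,
    LinearIsometryEquiv.norm_map] at h1
  rw [symbolPhi_apply]
  exact (sq_eq_sq₀ (norm_nonneg _) (norm_nonneg _)).1 h1

lemma inner_symbolPhi_left (hP : P.IsSymmetricProjection) {z : ℂ} (hz : ‖z‖ = 1) (x y : E) :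
    inner ℂ (symbolPhi U P z x) y = inner ℂ x (star z • symbolPsi U P z y) := by
  let F : E →ₗᵢ[ℂ] E := ⟨symbolPhi U P z, norm_symbolPhi_apply hP hz⟩
  have hzz : star z * z = 1 := by
    rw [Complex.star_def, ← Complex.normSq_eq_conj_mul_self, Complex.normSq_eq_norm_sq, hz]
    simp
  have hy : y = F (star z • symbolPsi U P z y) := by
    change y = symbolPhi U P z _
    rw [map_smul, symbolPhi_symbolPsi hP, smul_smul, hzz, one_smul]
  conv_lhs => rw [hy]
  exact F.inner_map_map x _

lemma exitsThroughTorus_bclVariety [FiniteDimensional ℂ E] (h : IsNondegenerate U P) :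
    (∃ S : Finset (MvPolynomial (Fin 2) ℂ),
      bclVariety U P = {z | z ∈ bidisc ∧ ∀ q ∈ S, evalAt q z = 0}) ∧
    ExitsThroughTorus (bclVariety U P) := by
  classical
  obtain ⟨q₁, hq₁⟩ := exists_mvPolynomial_evalAt_eq_det (P ∘ₗ U.symm.toLinearEquiv.toLinearMap)
    (-LinearMap.id) 0 ((LinearMap.id - P) ∘ₗ U.symm.toLinearEquiv.toLinearMap)
  obtain ⟨q₂, hq₂⟩ := exists_mvPolynomial_evalAt_eq_det
    (U.toLinearEquiv.toLinearMap ∘ₗ (LinearMap.id - P)) 0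
    (-LinearMap.id) (U.toLinearEquiv.toLinearMap ∘ₗ P)
  have e₁ (z : ℂ × ℂ) : evalAt q₁ z =
      LinearMap.det (symbolPhi U P (z.1 * z.2) - z.1 • LinearMap.id) := by
    rw [hq₁]; congr 1; ext v; simp [symbolPhi_apply]; abel
  have e₂ (z : ℂ × ℂ) : evalAt q₂ z =
      LinearMap.det (symbolPsi U P (z.1 * z.2) - z.2 • LinearMap.id) := by
    rw [hq₂]; congr 1; ext v; simp [symbolPsi_apply]; abel
  refine ⟨⟨{q₁, q₂}, ?_⟩, ExitsThroughTorus.of_forall (fun z hz => hz.1) ?_ ?_⟩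
  · ext z
    simp [bclVariety, e₁, e₂]
  · intro z hz h1 h2
    have hcl : IsClosed {z | evalAt q₁ z = 0} :=
      isClosed_eq (continuous_evalAt q₁) continuous_const
    have h0 : evalAt q₁ z = 0 :=
      closure_minimal (fun w hw => (e₁ w).trans hw.2.1) hcl hz
    rw [e₁, det_eq_zero_iff_exists] at h0
    obtain ⟨v, hv, hv'⟩ := h0
    refine (h.norm_lt_one_of_symbolPhi (z := z.1 * z.2) ?_ hv (sub_eq_zero.1 hv')).ne h1
    rwa [norm_mul, h1, one_mul]
  · intro z hz h1 h2
    have hcl : IsClosed {z | evalAt q₂ z = 0} :=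
      isClosed_eq (continuous_evalAt q₂) continuous_const
    have h0 : evalAt q₂ z = 0 :=
      closure_minimal (fun w hw => (e₂ w).trans hw.2.2) hcl hz
    rw [e₂, det_eq_zero_iff_exists] at h0
    obtain ⟨v, hv, hv'⟩ := h0
    refine (h.norm_lt_one_of_symbolPsi (z := z.1 * z.2) ?_ hv (sub_eq_zero.1 hv')).ne h1
    rwa [norm_mul, h1, mul_one]

lemma IsNondegenerate.nontrivial (h : IsNondegenerate U P) : Nontrivial E := by
  obtain ⟨v, hv, -⟩ := h.exists_apply_eq_self
  exact ⟨v, 0, hv⟩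

variable [FiniteDimensional ℂ E]

lemma IsNondegenerate.isAlgebraicDistinguishedVariety (h : IsNondegenerate U P) :
    IsAlgebraicDistinguishedVariety (bclVariety U P) :=
  ⟨⟨_, h.zero_mem_bclVariety⟩, exitsThroughTorus_bclVariety h⟩

/-- From `Ψ(c) Φ(c) = c`, an eigenvector of `Φ(c)` for `μ` is one of `Ψ(c)` for `c / μ`. -/
lemma IsNondegenerate.mem_reducedVariety (h : IsNondegenerate U P) {c μ : ℂ} (hc : ‖c‖ < 1)
    (hc0 : c ≠ 0) {v : E} (hv : v ≠ 0) (hμ : symbolPhi U P c v = μ • v) :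
    μ ≠ 0 ∧ (μ, c / μ) ∈ reducedVariety U P := by
  have h1 := symbolPsi_symbolPhi (U := U) h.1 c v
  rw [hμ, map_smul] at h1
  have hμ0 : μ ≠ 0 := by
    rintro rfl
    rw [zero_smul] at h1
    exact (smul_ne_zero hc0 hv) h1.symm
  have h2 : symbolPsi U P c v = (c / μ) • v := by
    rw [div_eq_inv_mul, mul_smul, ← h1, smul_smul, inv_mul_cancel₀ hμ0, one_smul]
  refine ⟨hμ0, ?_⟩
  have h3 : (μ, c / μ) ∈ bclVariety U P := by
    rw [mem_bclVariety_iff]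
    simp only [mul_div_cancel₀ c hμ0]
    exact ⟨⟨h.norm_lt_one_of_symbolPhi hc hv hμ, h.norm_lt_one_of_symbolPsi hc hv h2⟩,
      ⟨v, hv, hμ⟩, v, hv, h2⟩
  rw [h.bclVariety_eq] at h3
  refine h3.resolve_right fun h4 => hμ0 ?_
  exact congrArg Prod.fst h4

lemma IsNondegenerate.isDistinguishedVariety (h : IsNondegenerate U P) :
    IsDistinguishedVariety (reducedVariety U P) := by
  refine ⟨?_, ?_, h.isAlgebraicDistinguishedVariety.2.2.mono h.reducedVariety_subset⟩
  · have := h.nontrivial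
    obtain ⟨μ, hμ⟩ := Module.End.exists_eigenvalue (symbolPhi U P (1 / 2))
    obtain ⟨v, hv⟩ := hμ.exists_hasEigenvector
    exact ⟨_, (h.mem_reducedVariety (by norm_num) (by norm_num) hv.2 hv.apply_eq_smul).2⟩
  · obtain ⟨q, hq⟩ := exists_mvPolynomial_evalAt_eq_det
      (P - (LinearMap.id - P) ∘ₗ U.toLinearEquiv.toLinearMap)
      (-(P ∘ₗ U.toLinearEquiv.toLinearMap)) (LinearMap.id - P) (0 : E →ₗ[ℂ] E)
    exact ⟨q, by simp only [hq]; rfl⟩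

lemma IsNondegenerate.mem_closure_reducedVariety (h : IsNondegenerate U P) {z c : ℂ}
    (hz : ‖z‖ = 1) {v : E} (hv : v ≠ 0) (hc : symbolPhi U P z v = c • v) :
    (c, z / c) ∈ closure (reducedVariety U P) := by
  have := h.nontrivial
  have hc0 : c ≠ 0 := by
    rintro rfl
    have := norm_symbolPhi_apply (U := U) h.1 hz v
    rw [hc, zero_smul, norm_zero] at this
    exact hv (norm_eq_zero.1 this.symm)
  have hz0 : z ≠ 0 := by rintro rfl; simp at hz
  -- `q(w, 0)` is the characteristic polynomial of `Φ(w)` at the fixed point `c`; being polynomial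
  -- in `w`, it is continuous.
  obtain ⟨q, hq⟩ := exists_mvPolynomial_evalAt_eq_det
    (c • LinearMap.id - P ∘ₗ U.symm.toLinearEquiv.toLinearMap)
    (-((LinearMap.id - P) ∘ₗ U.symm.toLinearEquiv.toLinearMap)) 0 0
  have hq' (w : ℂ) : evalAt q (w, 0) = (symbolPhi U P w).charpoly.eval c := by
    rw [LinearMap.eval_charpoly, hq]
    congr 1; ext x; simp [symbolPhi_apply]; abel
  set d := Module.finrank ℂ E with hd_def
  have hd : 0 < d := Module.finrank_pos
  -- Radii `(n + 1)/(n + 2)`: nonzero, less than `1`, tending to `1`.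
  let r : ℕ → ℂ := fun n => 1 - 1 / ((n : ℂ) + 2)
  have hr : Tendsto r atTop (𝓝 1) := by
    have h1 := (tendsto_one_div_add_atTop_nhds_zero_nat (𝕜 := ℂ)).comp (tendsto_add_atTop_nat 1)
    have h2 := (tendsto_const_nhds (x := (1 : ℂ))).sub h1
    rw [sub_zero] at h2
    refine h2.congr fun n => ?_
    simp only [Function.comp_apply, r]
    push_cast
    ring_nf
  have hr' (n : ℕ) : r n = (((n : ℝ) + 1) / ((n : ℝ) + 2) : ℝ) := by
    have : (n : ℂ) + 2 ≠ 0 := by exact_mod_cast (by positivity : (n : ℝ) + 2 ≠ 0)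
    simp only [r]
    push_cast
    field_simp
    ring
  have hr0 (n : ℕ) : r n ≠ 0 := by
    rw [hr']; exact_mod_cast (by positivity : ((n : ℝ) + 1) / ((n : ℝ) + 2) ≠ 0)
  have hr1 (n : ℕ) : ‖r n‖ < 1 := by
    rw [hr', Complex.norm_real, Real.norm_of_nonneg (by positivity), div_lt_one (by positivity)]
    linarith
  have hex (n : ℕ) : ∃ b, b ∈ (symbolPhi U P (r n * z)).charpoly.roots ∧
      ‖c - b‖ ^ d ≤ ‖evalAt q (r n * z, 0)‖ := by
    have hdeg := (symbolPhi U P (r n * z)).charpoly_natDegree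
    obtain ⟨b, hb, hb'⟩ := exists_root_norm_sub_pow_le
      (symbolPhi U P (r n * z)).charpoly_monic (by rw [hdeg]; exact hd) c
    exact ⟨b, hb, by rw [hq', hd_def, ← hdeg]; exact hb'⟩
  choose b hb hbc using hex
  have hbW (n : ℕ) : (b n, r n * z / b n) ∈ reducedVariety U P := by
    have hev : Module.End.HasEigenvalue (symbolPhi U P (r n * z)) (b n) := by
      rw [Module.End.hasEigenvalue_iff_isRoot_charpoly]
      exact Polynomial.isRoot_of_mem_roots (hb n)
    obtain ⟨x, hx⟩ := hev.exists_hasEigenvector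
    exact (h.mem_reducedVariety (by rw [norm_mul, hz, mul_one]; exact hr1 n)
      (mul_ne_zero (hr0 n) hz0) hx.2 hx.apply_eq_smul).2
  have hrz : Tendsto (fun n => r n * z) atTop (𝓝 z) := by
    simpa using hr.mul_const z
  have hlim : Tendsto (fun n => ‖evalAt q (r n * z, 0)‖) atTop (𝓝 0) := by
    have h1 : Tendsto (fun n => ‖evalAt q (r n * z, 0)‖) atTop (𝓝 ‖evalAt q (z, 0)‖) :=
      ((continuous_evalAt q).norm.tendsto (z, 0)).comp (hrz.prodMk_nhds tendsto_const_nhds)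
    have h2 : evalAt q (z, 0) = 0 := by
      rw [hq', LinearMap.eval_charpoly, det_eq_zero_iff_exists]
      exact ⟨v, hv, by simp [hc]⟩
    rwa [h2, norm_zero] at h1
  have hblim : Tendsto b atTop (𝓝 c) := by
    rw [tendsto_iff_norm_sub_tendsto_zero]
    have h1 : Tendsto (fun n => ‖c - b n‖ ^ d) atTop (𝓝 0) :=
      squeeze_zero (fun n => by positivity) hbc hlim
    rw [Metric.tendsto_atTop] at h1 ⊢
    intro ε hε
    obtain ⟨N, hN⟩ := h1 (ε ^ d) (by positivity)
    refine ⟨N, fun n hn => ?_⟩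
    have h2 := hN n hn
    rw [Real.dist_0_eq_abs, abs_of_nonneg (by positivity)] at h2 ⊢
    rw [norm_sub_rev]
    exact lt_of_pow_lt_pow_left₀ d hε.le h2
  exact mem_closure_of_tendsto (hblim.prodMk_nhds (hrz.div hblim hc0))
    (Eventually.of_forall hbW)

lemma norm_evalAt_le_sSup {V : Set (ℂ × ℂ)} (hV : V ⊆ bidisc) (p : MvPolynomial (Fin 2) ℂ)
    {z : ℂ × ℂ} (hz : z ∈ closure V) :
    ‖evalAt p z‖ ≤ sSup ((fun z => ‖evalAt p z‖) '' V) := by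
  have hcl : IsClosed {z | ‖evalAt p z‖ ≤ sSup ((fun z => ‖evalAt p z‖) '' V)} :=
    isClosed_le (continuous_evalAt p).norm continuous_const
  exact closure_minimal
    (fun w hw => le_csSup (bddAbove_evalAt_image p hV) (Set.mem_image_of_mem _ hw)) hcl hz

lemma IsNondegenerate.norm_polySum_symbol_le (h : IsNondegenerate U P) {z : ℂ} (hz : ‖z‖ = 1)
    (p : MvPolynomial (Fin 2) ℂ) (x : E) :
    ‖polySum (A := Module.End ℂ E) p (symbolPhi U P z) (symbolPsi U P z) x‖ ≤
      sSup ((fun z => ‖evalAt p z‖) '' reducedVariety U P) * ‖x‖ := by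
  have := h.nontrivial
  have : CompleteSpace E := FiniteDimensional.complete ℂ E
  have hz0 : z ≠ 0 := by rintro rfl; simp at hz
  set F : Module.End ℂ E := symbolPhi U P z with hF
  set G : Module.End ℂ E := symbolPsi U P z with hG
  have hFG : F * G = z • 1 := LinearMap.ext fun v => symbolPhi_symbolPsi h.1 z v
  have hGF : G * F = z • 1 := LinearMap.ext fun v => symbolPsi_symbolPhi h.1 z v
  have hcFG : Commute F G := hFG.trans hGF.symm
  set N := polySum p F G with hN
  have hFN : Commute F N := commute_polySum p (Commute.refl F) hcFG
  have hGN : Commute G N := commute_polySum p hcFG.symm (Commute.refl G)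
  let e := Module.End.toContinuousLinearMap E (𝕜 := ℂ)
  have hstar : star (e F) = star z • e G := by
    rw [ContinuousLinearMap.star_eq_adjoint, eq_comm, ContinuousLinearMap.eq_adjoint_iff]
    intro y x
    have := inner_symbolPhi_left (U := U) h.1 hz x y
    rw [← inner_conj_symm, ← inner_conj_symm (𝕜 := ℂ) y]
    exact congrArg _ this.symm
  have hz1 : star z ≠ 0 := star_ne_zero.2 hz0
  have hG' : e G = (star z)⁻¹ • star (e F) := by rw [hstar, inv_smul_smul₀ hz1]
  have hF' : e F = z • star (e G) := by rw [← star_star (e F), hstar, star_smul, star_star]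
  -- The adjoint of each of `F`, `G` is a scalar multiple of the other, so everything commuting with
  -- both has an adjoint commuting with both; hence `N` is normal.
  have h1 : Commute (e F) (star (e N)) := by
    rw [hF']
    exact (((hGN.map e).star_star)).smul_left _
  have h2 : Commute (e G) (star (e N)) := by
    rw [hG']
    exact (((hFN.map e).star_star)).smul_left _
  have hnormal : IsStarNormal (e N) := by
    refine ⟨?_⟩
    have : e N = polySum p (e F) (e G) := map_polySum e p F G
    nth_rw 2 [this]
    exact commute_polySum p h1.symm h2.symm
  -- A normal operator attains its norm at a spectral value, here an eigenvalue. Its eigenspace is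
  -- invariant under `F`, and an eigenvector of `F` in it is one of `G` too, since `G F = z`.
  obtain ⟨μ, hμ, hμn⟩ := spectrum.exists_nnnorm_eq_spectralRadius (e N)
  rw [IsStarNormal.spectralRadius_eq_nnnorm] at hμn
  have hμn' : ‖e N‖ = ‖μ‖ := by
    have : ‖μ‖₊ = ‖e N‖₊ := by exact_mod_cast hμn
    exact congrArg NNReal.toReal this.symm
  rw [AlgEquiv.spectrum_eq e, ← Module.End.hasEigenvalue_iff_mem_spectrum] at hμ
  have hmaps : ∀ v ∈ N.eigenspace μ, F v ∈ N.eigenspace μ := fun v hv => by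
    rw [Module.End.mem_eigenspace_iff] at hv ⊢
    have := congrArg (· v) hFN.eq
    simp only [Module.End.mul_apply] at this
    rw [← this, hv, map_smul]
  obtain ⟨w, hw⟩ := hμ.exists_hasEigenvector
  have : Nontrivial (N.eigenspace μ) :=
    ⟨⟨w, hw.1⟩, 0, fun h0 => hw.2 (congrArg Subtype.val h0)⟩
  obtain ⟨c, hc⟩ := Module.End.exists_eigenvalue (F.restrict hmaps)
  obtain ⟨⟨v, hvμ⟩, hv⟩ := hc.exists_hasEigenvector
  have hv0 : v ≠ 0 := fun h0 => hv.2 (Subtype.ext h0)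
  have hFv : F v = c • v := congrArg Subtype.val hv.apply_eq_smul
  have hGFv : G (F v) = z • v := congrArg (· v) hGF
  rw [hFv, map_smul] at hGFv
  have hc0 : c ≠ 0 := by
    rintro rfl
    rw [zero_smul] at hGFv
    exact smul_ne_zero hz0 hv0 hGFv.symm
  have hGv : G v = (z / c) • v := by
    rw [div_eq_inv_mul, mul_smul, ← hGFv, smul_smul, inv_mul_cancel₀ hc0, one_smul]
  have hNv := polySum_apply_of_eigenvector p hFv hGv
  rw [← hN, Module.End.mem_eigenspace_iff.1 hvμ] at hNv
  have hμe : μ = evalAt p (c, z / c) := smul_left_injective ℂ hv0 hNv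
  calc ‖N x‖ = ‖e N x‖ := rfl
    _ ≤ ‖e N‖ * ‖x‖ := (e N).le_opNorm x
    _ ≤ _ := by
      gcongr
      rw [hμn', hμe]
      exact norm_evalAt_le_sSup (fun z hz => hz.1) p (h.mem_closure_reducedVariety hz hv0 hFv)

end Variety

/-! ### Multiplication operators on vector polynomials -/

section PolynomialSymbols

variable {E : Type*} [AddCommGroup E] [Module ℂ E]

/-- Evaluation at `ζ` of the vector polynomial `∑ zⁿ fₙ`. -/
noncomputable def evalVec (ζ : ℂ) : (ℕ →₀ E) →ₗ[ℂ] E :=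
  Finsupp.lsum ℂ fun n => ζ ^ n • LinearMap.id

/-- Multiplication of vector polynomials by the operator pencil `A + z B`. -/
noncomputable def mulPencil (A B : E →ₗ[ℂ] E) : Module.End ℂ (ℕ →₀ E) :=
  Finsupp.lsum ℂ fun n => Finsupp.lsingle n ∘ₗ A + Finsupp.lsingle (n + 1) ∘ₗ B

lemma evalVec_single (ζ : ℂ) (n : ℕ) (e : E) : evalVec ζ (Finsupp.single n e) = ζ ^ n • e := by
  simp only [evalVec, Finsupp.lsum_single, LinearMap.smul_apply, LinearMap.id_apply]

lemma mulPencil_single (A B : E →ₗ[ℂ] E) (n : ℕ) (e : E) :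
    mulPencil A B (Finsupp.single n e) =
      Finsupp.single n (A e) + Finsupp.single (n + 1) (B e) := by
  simp only [mulPencil, Finsupp.lsum_single, LinearMap.add_apply, LinearMap.comp_apply,
    Finsupp.lsingle_apply]

lemma evalVec_mulPencil (ζ : ℂ) (A B : E →ₗ[ℂ] E) :
    evalVec ζ ∘ₗ mulPencil A B = (A + ζ • B) ∘ₗ evalVec ζ := by
  refine Finsupp.lhom_ext fun n e => ?_
  simp [mulPencil_single, evalVec_single, pow_succ, mul_smul, smul_add]

lemma evalVec_eq_sum (ζ : ℂ) {f : ℕ →₀ E} {M : ℕ} (hM : f.support ⊆ Finset.range M) :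
    evalVec ζ f = ∑ n ∈ Finset.range M, ζ ^ n • f n := by
  rw [evalVec, Finsupp.lsum_apply, Finsupp.sum_of_support_subset _ hM _ (by simp)]
  rfl

lemma map_polySum_of_intertwine {F G : Type*} [AddCommGroup F] [Module ℂ F] [AddCommGroup G]
    [Module ℂ G] (p : MvPolynomial (Fin 2) ℂ) (L : F →ₗ[ℂ] G) {a b : Module.End ℂ F}
    {a' b' : Module.End ℂ G} (ha : L ∘ₗ a = a' ∘ₗ L) (hb : L ∘ₗ b = b' ∘ₗ L) (f : F) :
    L (polySum p a b f) = polySum p a' b' (L f) := by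
  have key {c : Module.End ℂ F} {c' : Module.End ℂ G} (h : L ∘ₗ c = c' ∘ₗ L) (n : ℕ) (f : F) :
      L ((c ^ n) f) = (c' ^ n) (L f) := by
    induction n with
    | zero => simp
    | succ n ih =>
      rw [pow_succ', pow_succ', Module.End.mul_apply, Module.End.mul_apply, ← ih]
      exact LinearMap.congr_fun h _
  simp [polySum, LinearMap.sum_apply, key ha, key hb]

end PolynomialSymbols

/-! ### Discrete Parseval identity -/

section Parseval

variable {E : Type*} [NormedAddCommGroup E] [InnerProductSpace ℂ E]

/-- Sampling at the `M`-th roots of unity replaces integration over the circle: characters with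
distinct exponents below `M` are orthogonal, by the geometric sum. -/
lemma sum_norm_sq_evalVec {M : ℕ} (hM0 : M ≠ 0) {ω : ℂ} (hω : IsPrimitiveRoot ω M)
    {f : ℕ →₀ E} (hM : f.support ⊆ Finset.range M) :
    ∑ j ∈ Finset.range M, ‖evalVec (ω ^ j) f‖ ^ 2 = M * ∑ n ∈ Finset.range M, ‖f n‖ ^ 2 := by
  have hω1 : star ω * ω = 1 := by
    rw [Complex.star_def, ← Complex.normSq_eq_conj_mul_self, Complex.normSq_eq_norm_sq,
      hω.norm'_eq_one hM0]
    simp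
  have horth {m n : ℕ} (hm : m < M) (hn : n < M) (hmn : m ≠ n) :
      ∑ j ∈ Finset.range M, star ((ω ^ j) ^ m) * (ω ^ j) ^ n = 0 := by
    have h1 : ∀ j, star ((ω ^ j) ^ m) * (ω ^ j) ^ n = (star (ω ^ m) * ω ^ n) ^ j := fun j => by
      rw [mul_pow, ← star_pow, ← pow_mul, ← pow_mul, ← pow_mul, ← pow_mul, mul_comm j, mul_comm j]
    simp_rw [h1]
    set x := star (ω ^ m) * ω ^ n with hx
    have hxM : x ^ M = 1 := by
      rw [hx, mul_pow, ← star_pow, ← pow_mul, ← pow_mul, mul_comm m, mul_comm n, pow_mul, pow_mul,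
        hω.pow_eq_one]
      simp
    have hx1 : x ≠ 1 := fun h => hmn <| hω.pow_inj hm hn <| by
      have h2 : ω ^ m * star (ω ^ m) = 1 := by
        rw [star_pow, ← mul_pow, mul_comm, hω1, one_pow]
      rw [← one_mul (ω ^ n), ← h2, mul_assoc, ← hx, h, mul_one]
    have h3 := mul_geom_sum x M
    rw [hxM, sub_self] at h3
    exact (mul_eq_zero.1 h3).resolve_left (sub_ne_zero.2 hx1)
  have hdiag (m j : ℕ) : star ((ω ^ j) ^ m) * (ω ^ j) ^ m = 1 := by
    rw [star_pow, star_pow, ← mul_pow, ← mul_pow, hω1, one_pow, one_pow]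
  have key : ∑ j ∈ Finset.range M, inner ℂ (evalVec (ω ^ j) f) (evalVec (ω ^ j) f) =
      (M : ℂ) * ∑ n ∈ Finset.range M, inner ℂ (f n) (f n) := by
    simp_rw [evalVec_eq_sum _ hM, sum_inner, inner_sum, inner_smul_left, inner_smul_right]
    rw [Finset.sum_comm, Finset.mul_sum]
    refine Finset.sum_congr rfl fun m hm => ?_
    rw [Finset.sum_comm, Finset.sum_eq_single_of_mem m hm]
    · simp_rw [← mul_assoc, ← Finset.sum_mul, starRingEnd_apply, hdiag]
      simp
    · intro n hn hnm
      simp_rw [← mul_assoc, ← Finset.sum_mul, starRingEnd_apply]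
      rw [horth (Finset.mem_range.1 hm) (Finset.mem_range.1 hn) hnm.symm, zero_mul]
  simp_rw [inner_self_eq_norm_sq_to_K] at key
  apply Complex.ofReal_injective
  push_cast
  exact key

end Parseval

/-! ### The dilation and the resulting norm bound -/

section Dilation

variable {H : Type*} [NormedAddCommGroup H] [InnerProductSpace ℂ H] [CompleteSpace H]
  {E : Type*} [NormedAddCommGroup E] [InnerProductSpace ℂ E] [CompleteSpace E]

/-- The relations between `T₁`, `T₂` and `B` which make `h ↦ ∑ zⁿ B (T₁ T₂)*ⁿ h` an isometry
intertwining `T₁*`, `T₂*` with the adjoints of the multiplications by `Φ` and `Ψ`. -/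
structure IsModelMap (T₁ T₂ : H →L[ℂ] H) (U : E ≃ₗᵢ[ℂ] E) (P : E →ₗ[ℂ] E) (B : H →L[ℂ] E) :
    Prop where
  comm : T₁ * T₂ = T₂ * T₁
  norm_le_one : ‖T₁ * T₂‖ ≤ 1
  tendsto_zero : ∀ h : H, Tendsto (fun m : ℕ => (adjoint (T₁ * T₂) ^ m) h) atTop (𝓝 0)
  isSymmetricProjection : P.IsSymmetricProjection
  adjoint_apply_apply : ∀ h, adjoint B (B h) = h - (T₁ * T₂) (adjoint (T₁ * T₂) h)
  apply_adjoint_left : ∀ h, B (adjoint T₁ h) =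
    U (P (B h) + (B (adjoint (T₁ * T₂) h) - P (B (adjoint (T₁ * T₂) h))))
  apply_adjoint_right : ∀ h, B (adjoint T₂ h) =
    (U.symm (B h) - P (U.symm (B h))) + P (U.symm (B (adjoint (T₁ * T₂) h)))

/-- The map `∑ zⁿ fₙ ↦ ∑ Tⁿ B* fₙ`. -/
noncomputable def synthesis (T : H →L[ℂ] H) (B : H →L[ℂ] E) : (ℕ →₀ E) →ₗ[ℂ] H :=
  Finsupp.lsum ℂ fun n => (T ^ n).toLinearMap ∘ₗ (adjoint B).toLinearMap

lemma synthesis_eq_sum (T : H →L[ℂ] H) (B : H →L[ℂ] E) {f : ℕ →₀ E} {M : ℕ}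
    (hM : f.support ⊆ Finset.range M) :
    synthesis T B f = ∑ n ∈ Finset.range M, (T ^ n) (adjoint B (f n)) := by
  rw [synthesis, Finsupp.lsum_apply, Finsupp.sum_of_support_subset _ hM _ (by simp)]
  rfl

lemma synthesis_single (T : H →L[ℂ] H) (B : H →L[ℂ] E) (n : ℕ) (e : E) :
    synthesis T B (Finsupp.single n e) = (T ^ n) (adjoint B e) := by
  simp only [synthesis, Finsupp.lsum_single]
  rfl

lemma synthesis_mulPencil {T X : H →L[ℂ] H} {B : H →L[ℂ] E} {A₀ A₁ : E →ₗ[ℂ] E}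
    (hT : Commute X T) (hX : ∀ e, X (adjoint B e) = adjoint B (A₀ e) + T (adjoint B (A₁ e))) :
    synthesis T B ∘ₗ mulPencil A₀ A₁ = X.toLinearMap ∘ₗ synthesis T B := by
  refine Finsupp.lhom_ext fun n e => ?_
  have h := congrArg (· (adjoint B e)) (hT.pow_right n).eq
  simp only [mul_apply_eq_comp, hX, map_add] at h
  rw [LinearMap.comp_apply, LinearMap.comp_apply, mulPencil_single, map_add, synthesis_single,
    synthesis_single, synthesis_single, pow_succ]
  exact h.symm

variable {T₁ T₂ : H →L[ℂ] H} {U : E ≃ₗᵢ[ℂ] E} {P : E →ₗ[ℂ] E} {B : H →L[ℂ] E}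

lemma adjoint_mul_pow (T : H →L[ℂ] H) (n : ℕ) : adjoint (T ^ n) = adjoint T ^ n :=
  star_pow T n

namespace IsModelMap

lemma norm_sq_apply (h : IsModelMap T₁ T₂ U P B) (x : H) :
    ‖B x‖ ^ 2 = ‖x‖ ^ 2 - ‖adjoint (T₁ * T₂) x‖ ^ 2 := by
  have h1 : inner ℂ (B x) (B x) = inner ℂ x x - inner ℂ (adjoint (T₁ * T₂) x)
      (adjoint (T₁ * T₂) x) := by
    rw [← adjoint_inner_left, h.adjoint_apply_apply, inner_sub_left, adjoint_inner_right]
  simp_rw [inner_self_eq_norm_sq_to_K] at h1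
  exact_mod_cast h1

lemma sum_norm_sq_apply (h : IsModelMap T₁ T₂ U P B) (x : H) (M : ℕ) :
    ∑ n ∈ Finset.range M, ‖B ((adjoint (T₁ * T₂) ^ n) x)‖ ^ 2 =
      ‖x‖ ^ 2 - ‖(adjoint (T₁ * T₂) ^ M) x‖ ^ 2 := by
  simp_rw [h.norm_sq_apply]
  have h1 (n : ℕ) : adjoint (T₁ * T₂) ((adjoint (T₁ * T₂) ^ n) x) =
      (adjoint (T₁ * T₂) ^ (n + 1)) x := by
    rw [pow_succ']
    rfl
  simp_rw [h1]
  rw [Finset.sum_range_sub' (fun n => ‖(adjoint (T₁ * T₂) ^ n) x‖ ^ 2) M, pow_zero]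
  rfl

/-- By duality: `synthesis` is adjoint to `x ↦ (B T*ⁿ x)ₙ` with `T = T₁ T₂`, which is contractive by
the telescoping sum `sum_norm_sq_apply`. -/
lemma norm_synthesis_le (h : IsModelMap T₁ T₂ U P B) {f : ℕ →₀ E} {M : ℕ}
    (hM : f.support ⊆ Finset.range M) :
    ‖synthesis (T₁ * T₂) B f‖ ≤ √(∑ n ∈ Finset.range M, ‖f n‖ ^ 2) := by
  set g := synthesis (T₁ * T₂) B f with hg
  have h1 : ‖g‖ ^ 2 ≤ √(∑ n ∈ Finset.range M, ‖f n‖ ^ 2) * ‖g‖ := by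
    calc ‖g‖ ^ 2 = ‖(inner ℂ g g : ℂ)‖ := by rw [inner_self_eq_norm_sq_to_K]; simp
      _ = ‖∑ n ∈ Finset.range M, (inner ℂ (f n) (B ((adjoint (T₁ * T₂) ^ n) g)) : ℂ)‖ := by
        congr 1
        nth_rw 1 [hg]
        rw [synthesis_eq_sum _ _ hM, sum_inner]
        refine Finset.sum_congr rfl fun n _ => ?_
        rw [← adjoint_mul_pow, ← adjoint_inner_left, adjoint_inner_right]
      _ ≤ ∑ n ∈ Finset.range M, ‖f n‖ * ‖B ((adjoint (T₁ * T₂) ^ n) g)‖ :=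
        norm_sum_le_of_le _ fun n _ => norm_inner_le_norm _ _
      _ ≤ √(∑ n ∈ Finset.range M, ‖f n‖ ^ 2) *
          √(∑ n ∈ Finset.range M, ‖B ((adjoint (T₁ * T₂) ^ n) g)‖ ^ 2) :=
        Real.sum_mul_le_sqrt_mul_sqrt _ _ _
      _ ≤ _ := by
        gcongr
        rw [h.sum_norm_sq_apply, Real.sqrt_le_left (norm_nonneg g)]
        exact sub_le_self _ (sq_nonneg _)
  rcases (norm_nonneg g).eq_or_lt with h0 | h0
  · rw [← h0]; exact Real.sqrt_nonneg _
  · rw [sq] at h1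
    exact le_of_mul_le_mul_right h1 h0

lemma left_apply_adjoint (h : IsModelMap T₁ T₂ U P B) (e : E) :
    T₁ (adjoint B e) = adjoint B ((P ∘ₗ U.symm.toLinearEquiv.toLinearMap) e) +
      (T₁ * T₂) (adjoint B (((LinearMap.id - P) ∘ₗ U.symm.toLinearEquiv.toLinearMap) e)) := by
  refine ext_inner_right ℂ fun x => ?_
  have hU (a b : E) : inner ℂ a (U b) = inner ℂ (U.symm a) b := by
    rw [← U.symm.inner_map_map, U.symm_apply_apply]
  rw [← adjoint_inner_right, adjoint_inner_left, h.apply_adjoint_left, inner_add_left,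
    adjoint_inner_left, ← adjoint_inner_right (T₁ * T₂), adjoint_inner_left, hU, inner_add_right,
    inner_sub_right]
  simp only [LinearMap.comp_apply, LinearMap.sub_apply, LinearMap.id_apply, inner_sub_left]
  rw [h.isSymmetricProjection.2 _ (B x), h.isSymmetricProjection.2 _ (B _)]
  rfl

lemma right_apply_adjoint (h : IsModelMap T₁ T₂ U P B) (e : E) :
    T₂ (adjoint B e) = adjoint B ((U.toLinearEquiv.toLinearMap ∘ₗ (LinearMap.id - P)) e) +
      (T₁ * T₂) (adjoint B ((U.toLinearEquiv.toLinearMap ∘ₗ P) e)) := by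
  refine ext_inner_right ℂ fun x => ?_
  have hU (a b : E) : inner ℂ (U a) b = inner ℂ a (U.symm b) := by
    rw [← U.symm.inner_map_map, U.symm_apply_apply]
  rw [← adjoint_inner_right, adjoint_inner_left, h.apply_adjoint_right, inner_add_left,
    adjoint_inner_left, ← adjoint_inner_right (T₁ * T₂), adjoint_inner_left, inner_add_right,
    inner_sub_right]
  simp only [LinearMap.comp_apply]
  change _ = inner ℂ (U (e - P e)) _ + inner ℂ (U (P e)) _
  rw [hU, hU, inner_sub_left, h.isSymmetricProjection.2 _ (U.symm _),
    h.isSymmetricProjection.2 _ (U.symm _)]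

variable {p : MvPolynomial (Fin 2) ℂ} {C : ℝ}

lemma norm_polySum_synthesis_le (h : IsModelMap T₁ T₂ U P B) (hC : 0 ≤ C)
    (hp : ∀ z : ℂ, ‖z‖ = 1 → ∀ x : E, ‖polySum (A := Module.End ℂ E) p (symbolPhi U P z)
      (symbolPsi U P z) x‖ ≤ C * ‖x‖) {f : ℕ →₀ E} {N : ℕ} (hN : f.support ⊆ Finset.range N) :
    ‖polySum p T₁ T₂ (synthesis (T₁ * T₂) B f)‖ ≤
      C * √(∑ n ∈ Finset.range N, ‖f n‖ ^ 2) := by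
  set F := mulPencil (P ∘ₗ U.symm.toLinearEquiv.toLinearMap)
    ((LinearMap.id - P) ∘ₗ U.symm.toLinearEquiv.toLinearMap)
  set G := mulPencil (U.toLinearEquiv.toLinearMap ∘ₗ (LinearMap.id - P))
    (U.toLinearEquiv.toLinearMap ∘ₗ P)
  set g := polySum p F G f
  have hev (z : ℂ) : evalVec z g = polySum (A := Module.End ℂ E) p (symbolPhi U P z)
      (symbolPsi U P z) (evalVec z f) := by
    refine map_polySum_of_intertwine p (evalVec z) ?_ ?_ f
    · rw [evalVec_mulPencil]; congr 1
    · rw [evalVec_mulPencil]; congr 1; ext; simp [symbolPsi_apply]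
  have hc₁ : Commute T₁ (T₁ * T₂) := (Commute.refl _).mul_right h.comm
  have hc₂ : Commute T₂ (T₁ * T₂) := (show Commute T₂ T₁ from h.comm.symm).mul_right (Commute.refl _)
  have hsyn : synthesis (T₁ * T₂) B g = polySum p T₁ T₂ (synthesis (T₁ * T₂) B f) := by
    have h1 := map_polySum_of_intertwine p (synthesis (T₁ * T₂) B) (a := F) (b := G)
      (a' := T₁.toLinearMap) (b' := T₂.toLinearMap)
      (synthesis_mulPencil hc₁ h.left_apply_adjoint)
      (synthesis_mulPencil hc₂ h.right_apply_adjoint) f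
    rw [h1]
    simp [polySum, LinearMap.sum_apply,
      ← ContinuousLinearMap.toLinearMap_pow]
  obtain ⟨K, hK⟩ : ∃ K, f.support ∪ g.support ⊆ Finset.range K :=
    Finset.exists_nat_subset_range _
  -- `M` exceeds the degrees of `f` and `g`, and is positive so that a primitive `M`-th root of
  -- unity exists.
  set M := max (max N K) 1
  have hfM : f.support ⊆ Finset.range M := hN.trans (Finset.range_mono (by omega))
  have hgM : g.support ⊆ Finset.range M :=
    (Finset.subset_union_right.trans hK).trans (Finset.range_mono (by omega))
  have hM0 : M ≠ 0 := by omega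
  have hω := Complex.isPrimitiveRoot_exp M hM0
  set ω := Complex.exp (2 * Real.pi * Complex.I / M)
  have hle : ∑ n ∈ Finset.range M, ‖g n‖ ^ 2 ≤ C ^ 2 * ∑ n ∈ Finset.range M, ‖f n‖ ^ 2 := by
    have hMpos : (0 : ℝ) < M := by exact_mod_cast Nat.pos_of_ne_zero hM0
    refine le_of_mul_le_mul_left ?_ hMpos
    rw [mul_left_comm, ← sum_norm_sq_evalVec hM0 hω hgM, ← sum_norm_sq_evalVec hM0 hω hfM,
      Finset.mul_sum]
    refine Finset.sum_le_sum fun j _ => ?_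
    rw [hev, ← mul_pow]
    exact pow_le_pow_left₀ (norm_nonneg _)
      (hp _ (by rw [norm_pow, hω.norm'_eq_one hM0, one_pow]) _) 2
  have hfN : ∑ n ∈ Finset.range M, ‖f n‖ ^ 2 = ∑ n ∈ Finset.range N, ‖f n‖ ^ 2 := by
    refine (Finset.sum_subset (Finset.range_mono (by omega)) fun n _ hn => ?_).symm
    have : f n = 0 := Finsupp.notMem_support_iff.1 fun h0 => hn (hN h0)
    simp [this]
  rw [← hsyn, ← hfN]
  refine (h.norm_synthesis_le hgM).trans ?_
  rw [← Real.sqrt_sq hC, ← Real.sqrt_mul (sq_nonneg C)]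
  exact Real.sqrt_le_sqrt hle

lemma norm_polyEval_le (h : IsModelMap T₁ T₂ U P B) (hC : 0 ≤ C)
    (hp : ∀ z : ℂ, ‖z‖ = 1 → ∀ x : E, ‖polySum (A := Module.End ℂ E) p (symbolPhi U P z)
      (symbolPsi U P z) x‖ ≤ C * ‖x‖) : ‖polyEval p T₁ T₂‖ ≤ C := by
  refine ContinuousLinearMap.opNorm_le_bound _ hC fun x => ?_
  set T := T₁ * T₂
  -- Truncations of the isometric image `∑ zⁿ B T*ⁿ x`. Their norm is at most `‖x‖`, and their
  -- synthesis telescopes to `x - T^N T*^N x`, which tends to `x`.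
  let f (N : ℕ) : ℕ →₀ E :=
    Finsupp.onFinset (Finset.range N)
      (fun n => if n ∈ Finset.range N then B ((adjoint T ^ n) x) else 0)
      (fun n hn => by by_contra h0; simp [h0] at hn)
  have hsupp (N : ℕ) : (f N).support ⊆ Finset.range N := Finsupp.support_onFinset_subset
  have hf {N n : ℕ} (hn : n ∈ Finset.range N) : f N n = B ((adjoint T ^ n) x) := by
    simp only [f, Finsupp.onFinset_apply, if_pos hn]
  have hsynth (N : ℕ) : synthesis T B (f N) = x - (T ^ N) ((adjoint T ^ N) x) := by
    rw [synthesis_eq_sum _ _ (hsupp N)]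
    have h0 : x - (T ^ N) ((adjoint T ^ N) x) = (T ^ 0) ((adjoint T ^ 0) x) -
      (T ^ N) ((adjoint T ^ N) x) := by simp
    rw [h0, ← Finset.sum_range_sub' fun n => (T ^ n) ((adjoint T ^ n) x)]
    refine Finset.sum_congr rfl fun n hn => ?_
    rw [hf hn, h.adjoint_apply_apply, map_sub, pow_succ' (adjoint T), pow_succ T]
    rfl
  have hbound (N : ℕ) : ‖polyEval p T₁ T₂ (synthesis T B (f N))‖ ≤ C * ‖x‖ := by
    refine (h.norm_polySum_synthesis_le hC hp (hsupp N)).trans ?_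
    gcongr
    rw [Real.sqrt_le_left (norm_nonneg x),
      Finset.sum_congr rfl fun n hn => by rw [hf hn], h.sum_norm_sq_apply]
    exact sub_le_self _ (sq_nonneg _)
  have hpow (N : ℕ) (y : H) : ‖(T ^ N) y‖ ≤ ‖y‖ := by
    induction N with
    | zero => simp
    | succ N ih =>
      rw [pow_succ']
      exact (T.le_of_opNorm_le h.norm_le_one _).trans (by rwa [one_mul])
  have hlim : Tendsto (fun N => synthesis T B (f N)) atTop (𝓝 x) := by
    simp_rw [hsynth]
    have h1 : Tendsto (fun N => (T ^ N) ((adjoint T ^ N) x)) atTop (𝓝 0) := by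
      refine squeeze_zero_norm (fun N => ?_) (tendsto_zero_iff_norm_tendsto_zero.1
        (h.tendsto_zero x))
      exact hpow N _
    simpa using tendsto_const_nhds.sub h1
  exact le_of_tendsto' (((polyEval p T₁ T₂).continuous.tendsto x).comp hlim).norm hbound

end IsModelMap

end Dilation

/-- Equal norms make `A x ↦ B x` a well-defined isometry on the range of `A`; in finite dimension it
extends to a unitary. -/
lemma exists_linearIsometryEquiv_of_norm_eq {F E : Type*} [AddCommGroup F] [Module ℂ F]
    [NormedAddCommGroup E] [InnerProductSpace ℂ E] [FiniteDimensional ℂ E] (A B : F →ₗ[ℂ] E)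
    (h : ∀ x, ‖A x‖ = ‖B x‖) : ∃ U : E ≃ₗᵢ[ℂ] E, ∀ x, U (A x) = B x := by
  have hker : A.ker ≤ B.ker := fun x hx => by
    rw [LinearMap.mem_ker] at hx ⊢
    rw [← norm_eq_zero, ← h, hx, norm_zero]
  let L : LinearMap.range A →ₗ[ℂ] E :=
    (A.ker.liftQ B hker) ∘ₗ A.quotKerEquivRange.symm.toLinearMap
  have hL (x : F) : L ⟨A x, x, rfl⟩ = B x := by
    have : A.quotKerEquivRange.symm ⟨A x, x, rfl⟩ = A.ker.mkQ x :=
      A.quotKerEquivRange_symm_apply_image x ⟨x, rfl⟩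
    simp [L, this]
  let L' : LinearMap.range A →ₗᵢ[ℂ] E := ⟨L, by
    rintro ⟨_, x, rfl⟩
    rw [hL]
    exact (h x).symm⟩
  refine ⟨L'.extend.toLinearIsometryEquiv rfl, fun x => ?_⟩
  exact (L'.extend_apply ⟨A x, x, rfl⟩).trans (hL x)

/-! ### Defect operators and the canonical unitary -/

section Operators

variable {H : Type*} [NormedAddCommGroup H] [InnerProductSpace ℂ H] [CompleteSpace H]

lemma defectOp_mul_self {T : H →L[ℂ] H} (hT : ‖T‖ ≤ 1) :
    defectOp T * defectOp T = 1 - T * adjoint T := by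
  refine CFC.sqrt_mul_sqrt_self _ (sub_nonneg.2 ?_)
  have h0 : 0 ≤ T * adjoint T := mul_star_self_nonneg T
  rw [← CStarAlgebra.norm_le_one_iff_of_nonneg _ h0]
  refine (norm_mul_le _ _).trans ?_
  rw [LinearIsometryEquiv.norm_map]
  exact mul_le_one₀ hT (norm_nonneg _) hT

lemma inner_defectVec {T : H →L[ℂ] H} (hT : ‖T‖ ≤ 1) (x y : H) :
    inner ℂ (defectVec T x) (defectVec T y) = inner ℂ x y - inner ℂ (adjoint T x) (adjoint T y) := by
  have hsa : adjoint (defectOp T) = defectOp T :=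
    (IsSelfAdjoint.of_nonneg (CFC.sqrt_nonneg _)).star_eq
  have h1 := congrArg (· x) (defectOp_mul_self hT)
  change defectOp T (defectOp T x) = x - T (adjoint T x) at h1
  change inner ℂ (defectOp T x) (defectOp T y) = _
  rw [← adjoint_inner_left, hsa, h1, inner_sub_left, adjoint_inner_right]

lemma norm_sq_defectVec {T : H →L[ℂ] H} (hT : ‖T‖ ≤ 1) (x : H) :
    ‖defectVec T x‖ ^ 2 = ‖x‖ ^ 2 - ‖adjoint T x‖ ^ 2 := by
  have h1 := inner_defectVec hT x x
  simp_rw [inner_self_eq_norm_sq_to_K] at h1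
  exact_mod_cast h1

lemma eq_zero_of_forall_inner_defectVec {T : H →L[ℂ] H} {u : defectSpace T}
    (hu : ∀ x, inner ℂ (defectVec T x) u = 0) : u = 0 := by
  have hcl : IsClosed {w : H | inner ℂ w (u : H) = 0} :=
    isClosed_eq (by fun_prop) continuous_const
  have h1 : (u : H) ∈ {w : H | inner ℂ w (u : H) = 0} := by
    refine closure_minimal ?_ hcl u.2
    rintro _ ⟨x, rfl⟩
    exact hu x
  exact Subtype.ext (inner_self_eq_zero.1 h1)

/-- If the defect space vanished, `T*` would be isometric, against purity. -/
lemma IsPureContraction.exists_defectSpace_ne_zero [Nontrivial H] {T : H →L[ℂ] H}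
    (hT : IsPureContraction T) : ∃ u : defectSpace T, u ≠ 0 := by
  by_contra! h
  obtain ⟨x, hx⟩ := exists_ne (0 : H)
  have h1 (y : H) : ‖adjoint T y‖ = ‖y‖ := by
    have := norm_sq_defectVec hT.norm_le_one y
    rw [h (defectVec T y), norm_zero] at this
    exact (sq_eq_sq₀ (norm_nonneg _) (norm_nonneg _)).1 (by linarith)
  have h2 (m : ℕ) : ‖(adjoint T ^ m) x‖ = ‖x‖ := by
    induction m with
    | zero => simp
    | succ m ih => rw [pow_succ', ← ih]; exact h1 _
  have h3 := (hT.tendsto_zero x).norm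
  simp_rw [h2, norm_zero] at h3
  exact hx (norm_eq_zero.1 (tendsto_nhds_unique tendsto_const_nhds h3))

/-- `h ↦ D_{T*} h` as a bounded operator into the defect space. -/
noncomputable def defectMap (T : H →L[ℂ] H) : H →L[ℂ] defectSpace T :=
  (defectOp T).codRestrict (defectSpace T) fun h => (defectVec T h).2

/-- The operator `h ↦ (D_{T₁*} h, D_{T₂*} T₁* h)`. -/
noncomputable def modelMap (T₁ T₂ : H →L[ℂ] H) : H →L[ℂ] DefectSum T₁ T₂ :=
  (WithLp.prodContinuousLinearEquiv 2 ℂ (defectSpace T₁) (defectSpace T₂)).symm.toContinuousLinearMap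
    ∘L ((defectMap T₁).prod (defectMap T₂ ∘L adjoint T₁))

/-- The operator `h ↦ (D_{T₁*} T₂* h, D_{T₂*} h)`. -/
noncomputable def modelMapSwap (T₁ T₂ : H →L[ℂ] H) : H →L[ℂ] DefectSum T₁ T₂ :=
  (WithLp.prodContinuousLinearEquiv 2 ℂ (defectSpace T₁) (defectSpace T₂)).symm.toContinuousLinearMap
    ∘L ((defectMap T₁ ∘L adjoint T₂).prod (defectMap T₂))

lemma modelMap_apply (T₁ T₂ : H →L[ℂ] H) (h : H) :
    modelMap T₁ T₂ h = WithLp.toLp 2 (defectVec T₁ h, defectVec T₂ (adjoint T₁ h)) := rfl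

lemma modelMapSwap_apply (T₁ T₂ : H →L[ℂ] H) (h : H) :
    modelMapSwap T₁ T₂ h = WithLp.toLp 2 (defectVec T₁ (adjoint T₂ h), defectVec T₂ h) := rfl

variable {T₁ T₂ : H →L[ℂ] H}

lemma adjoint_mul_apply (T₁ T₂ : H →L[ℂ] H) (h : H) :
    adjoint (T₁ * T₂) h = adjoint T₂ (adjoint T₁ h) := by
  rw [show adjoint (T₁ * T₂) = adjoint T₂ * adjoint T₁ from star_mul T₁ T₂]
  rfl

lemma adjoint_comm_apply (hcomm : T₁ * T₂ = T₂ * T₁) (h : H) :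
    adjoint T₁ (adjoint T₂ h) = adjoint T₂ (adjoint T₁ h) := by
  rw [← adjoint_mul_apply, ← adjoint_mul_apply, hcomm]

lemma exists_isCanonicalUnitary (hcomm : T₁ * T₂ = T₂ * T₁) (h₁ : ‖T₁‖ ≤ 1) (h₂ : ‖T₂‖ ≤ 1)
    [FiniteDimensional ℂ (defectSpace T₁)] [FiniteDimensional ℂ (defectSpace T₂)] :
    ∃ U, IsCanonicalUnitary T₁ T₂ U := by
  have : FiniteDimensional ℂ (DefectSum T₁ T₂) :=
    (WithLp.linearEquiv 2 ℂ (defectSpace T₁ × defectSpace T₂)).symm.finiteDimensional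
  refine exists_linearIsometryEquiv_of_norm_eq (modelMapSwap T₁ T₂).toLinearMap
    (modelMap T₁ T₂).toLinearMap fun x => ?_
  rw [← sq_eq_sq₀ (norm_nonneg _) (norm_nonneg _)]
  change ‖modelMapSwap T₁ T₂ x‖ ^ 2 = ‖modelMap T₁ T₂ x‖ ^ 2
  rw [WithLp.prod_norm_sq_eq_of_L2, WithLp.prod_norm_sq_eq_of_L2, modelMap_apply,
    modelMapSwap_apply, WithLp.toLp_fst, WithLp.toLp_snd, WithLp.toLp_fst, WithLp.toLp_snd]
  rw [norm_sq_defectVec h₁, norm_sq_defectVec h₁, norm_sq_defectVec h₂, norm_sq_defectVec h₂,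
    adjoint_comm_apply hcomm]
  ring

lemma isSymmetricProjection_sndProj (T₁ T₂ : H →L[ℂ] H) :
    (sndProj T₁ T₂).IsSymmetricProjection := by
  refine ⟨LinearMap.ext fun x => rfl, fun x y => ?_⟩
  rw [WithLp.prod_inner_apply, WithLp.prod_inner_apply]
  simp [sndProj]

/-- Iterating the hypothesis replaces `x` by `T*ᵐ x → 0`, so `u` is orthogonal to a dense subspace.
-/
lemma eq_zero_of_norm_inner_defectVec_eq {S T : H →L[ℂ] H} (hT : IsPureContraction T)
    {u : defectSpace S} (hu : ∀ x, ‖(inner ℂ (defectVec S (adjoint T x)) u : ℂ)‖ =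
      ‖(inner ℂ (defectVec S x) u : ℂ)‖) : u = 0 := by
  refine eq_zero_of_forall_inner_defectVec fun x => ?_
  have h1 (m : ℕ) : ‖(inner ℂ (defectVec S ((adjoint T ^ m) x)) u : ℂ)‖ =
      ‖(inner ℂ (defectVec S x) u : ℂ)‖ := by
    induction m with
    | zero => simp
    | succ m ih => rw [pow_succ', ← ih]; exact hu _
  have h2 : Tendsto (fun m : ℕ => ‖(inner ℂ (defectVec S ((adjoint T ^ m) x)) u : ℂ)‖) atTop
      (𝓝 ‖(inner ℂ (defectVec S 0) u : ℂ)‖) := by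
    have hc : Continuous fun y => ‖(inner ℂ (defectMap S y) u : ℂ)‖ := by fun_prop
    exact (hc.tendsto 0).comp (hT.tendsto_zero x)
  simp_rw [h1] at h2
  have h3 : defectVec S 0 = 0 := map_zero (defectMap S)
  rw [h3, inner_zero_left, norm_zero] at h2
  exact norm_eq_zero.1 (tendsto_nhds_unique tendsto_const_nhds h2)

lemma norm_inner_apply_eq_of_eigenvector {E : Type*} [NormedAddCommGroup E]
    [InnerProductSpace ℂ E] {U : E ≃ₗᵢ[ℂ] E} {u : E} {c : ℂ} (hu : U u = c • u) (x : E) :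
    ‖(inner ℂ (U x) u : ℂ)‖ = ‖(inner ℂ x u : ℂ)‖ := by
  by_cases hu0 : u = 0
  · simp [hu0]
  have hc : ‖c‖ = 1 := by
    have := U.norm_map u
    rw [hu, norm_smul] at this
    exact mul_right_cancel₀ (norm_ne_zero_iff.2 hu0) (this.trans (one_mul _).symm)
  rw [← U.inner_map_map x u, hu, inner_smul_right, norm_mul, hc, one_mul]

namespace IsCanonicalUnitary

variable {U : DefectSum T₁ T₂ ≃ₗᵢ[ℂ] DefectSum T₁ T₂}

lemma isNondegenerate [Nontrivial H] (hU : IsCanonicalUnitary T₁ T₂ U)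
    (h₁ : IsPureContraction T₁) (h₂ : IsPureContraction T₂) :
    IsNondegenerate U (sndProj T₁ T₂) := by
  obtain ⟨u₁, hu₁⟩ := h₁.exists_defectSpace_ne_zero
  obtain ⟨u₂, hu₂⟩ := h₂.exists_defectSpace_ne_zero
  refine ⟨isSymmetricProjection_sndProj T₁ T₂,
    ⟨WithLp.toLp 2 (u₁, 0), fun h => hu₁ (congrArg WithLp.fst h), rfl⟩,
    ⟨WithLp.toLp 2 (0, u₂), fun h => hu₂ (congrArg WithLp.snd h), rfl⟩,
    fun v c hv hc => ?_, fun v c hv hc => ?_⟩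
  · have hv1 : v.fst = 0 := (congrArg WithLp.fst hv).symm
    have hv2 : v.snd = 0 := by
      refine eq_zero_of_norm_inner_defectVec_eq h₁ fun x => ?_
      -- Pairing with an eigenvector of `U` has the same modulus before and after applying `U`. As
      -- `v.fst = 0`, only `D_{T₂*} x` and `D_{T₂*} T₁* x` remain.
      have h := norm_inner_apply_eq_of_eigenvector hc (modelMapSwap T₁ T₂ x)
      rw [modelMapSwap_apply, hU, WithLp.prod_inner_apply, WithLp.prod_inner_apply] at h
      simpa [hv1] using h
    exact WithLp.ofLp_injective 2 (Prod.ext hv1 hv2)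
  · have hv2 : v.snd = 0 := congrArg WithLp.snd hv
    have hv1 : v.fst = 0 := by
      refine eq_zero_of_norm_inner_defectVec_eq h₂ fun x => ?_
      have h := norm_inner_apply_eq_of_eigenvector hc (modelMapSwap T₁ T₂ x)
      rw [modelMapSwap_apply, hU, WithLp.prod_inner_apply, WithLp.prod_inner_apply] at h
      simpa [hv2] using h.symm
    exact WithLp.ofLp_injective 2 (Prod.ext hv1 hv2)

lemma isModelMap [FiniteDimensional ℂ (defectSpace T₁)] [FiniteDimensional ℂ (defectSpace T₂)]
    [CompleteSpace (DefectSum T₁ T₂)]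
    (hU : IsCanonicalUnitary T₁ T₂ U) (hcomm : T₁ * T₂ = T₂ * T₁)
    (h₁ : IsPureContraction T₁) (h₂ : IsPureContraction T₂) :
    IsModelMap T₁ T₂ U (sndProj T₁ T₂) (modelMap T₁ T₂) where
  comm := hcomm
  norm_le_one := (norm_mul_le _ _).trans
    (mul_le_one₀ h₁.norm_le_one (norm_nonneg _) h₂.norm_le_one)
  tendsto_zero h := by
    refine squeeze_zero_norm (fun m => ?_)
      (tendsto_zero_iff_norm_tendsto_zero.1 (h₁.tendsto_zero h))
    have hc : Commute (adjoint T₂) (adjoint T₁) :=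
      ContinuousLinearMap.ext fun x => (adjoint_comm_apply hcomm x).symm
    rw [show adjoint (T₁ * T₂) = adjoint T₂ * adjoint T₁ from star_mul T₁ T₂, hc.mul_pow]
    have hpow (y : H) : ‖(adjoint T₂ ^ m) y‖ ≤ ‖y‖ := by
      induction m with
      | zero => simp
      | succ m ih =>
        rw [pow_succ']
        refine ((adjoint T₂).le_of_opNorm_le ?_ _).trans (by rwa [one_mul])
        rw [LinearIsometryEquiv.norm_map]
        exact h₂.norm_le_one
    exact hpow _
  isSymmetricProjection := isSymmetricProjection_sndProj T₁ T₂
  adjoint_apply_apply h := by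
    refine ext_inner_right ℂ fun x => ?_
    rw [adjoint_inner_left, inner_sub_left, ← adjoint_inner_right (T₁ * T₂), modelMap_apply, modelMap_apply,
      WithLp.prod_inner_apply]
    simp only
    rw [inner_defectVec h₁.norm_le_one, inner_defectVec h₂.norm_le_one, adjoint_mul_apply,
      adjoint_mul_apply]
    ring
  apply_adjoint_left h := by
    have := hU (adjoint T₁ h)
    rw [modelMap_apply, ← this, adjoint_mul_apply]
    congr 1
    refine WithLp.ofLp_injective 2 (Prod.ext ?_ ?_) <;> simp [sndProj, modelMap_apply]
  apply_adjoint_right h := by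
    have hsymm (x : H) : U.symm (modelMap T₁ T₂ x) = modelMapSwap T₁ T₂ x := by
      rw [LinearIsometryEquiv.symm_apply_eq]
      exact (hU x).symm
    rw [hsymm, hsymm, adjoint_mul_apply]
    refine WithLp.ofLp_injective 2 (Prod.ext ?_ ?_) <;>
      simp [sndProj, modelMap_apply, modelMapSwap_apply, adjoint_comm_apply hcomm]

end IsCanonicalUnitary

end Operators

end BCL

theorem theorem6p2 {H : Type*} [NormedAddCommGroup H] [InnerProductSpace ℂ H] [CompleteSpace H]
    [Nontrivial H] (T₁ T₂ : H →L[ℂ] H) (hcomm : T₁ * T₂ = T₂ * T₁)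
    (h₁ : BCL.IsPureContraction T₁) (h₂ : BCL.IsPureContraction T₂)
    (hd₁ : FiniteDimensional ℂ (BCL.defectSpace T₁))
    (hd₂ : FiniteDimensional ℂ (BCL.defectSpace T₂)) :
    ∃ U : BCL.DefectSum T₁ T₂ ≃ₗᵢ[ℂ] BCL.DefectSum T₁ T₂,
      BCL.IsCanonicalUnitary T₁ T₂ U ∧
      BCL.IsAlgebraicDistinguishedVariety (BCL.bclVariety U (BCL.sndProj T₁ T₂)) ∧
      (∀ p : MvPolynomial (Fin 2) ℂ,
        ‖BCL.polyEval p T₁ T₂‖ ≤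
          sSup ((fun z => ‖BCL.evalAt p z‖) '' BCL.bclVariety U (BCL.sndProj T₁ T₂))) ∧
      ∃ W : Set (ℂ × ℂ),
        BCL.IsDistinguishedVariety W ∧
        BCL.bclVariety U (BCL.sndProj T₁ T₂) = W ∪ {(0, 0)} ∧
        ∀ p : MvPolynomial (Fin 2) ℂ,
          ‖BCL.polyEval p T₁ T₂‖ ≤ sSup ((fun z => ‖BCL.evalAt p z‖) '' W) := by
  have hfd : FiniteDimensional ℂ (BCL.DefectSum T₁ T₂) :=
    (WithLp.linearEquiv 2 ℂ (BCL.defectSpace T₁ × BCL.defectSpace T₂)).symm.finiteDimensional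
  have : CompleteSpace (BCL.DefectSum T₁ T₂) := FiniteDimensional.complete ℂ _
  obtain ⟨U, hU⟩ := BCL.exists_isCanonicalUnitary hcomm h₁.norm_le_one h₂.norm_le_one
  have hnd := hU.isNondegenerate h₁ h₂
  have hW := hnd.isDistinguishedVariety
  have hle (p : MvPolynomial (Fin 2) ℂ) : ‖BCL.polyEval p T₁ T₂‖ ≤
      sSup ((fun z => ‖BCL.evalAt p z‖) '' BCL.reducedVariety U (BCL.sndProj T₁ T₂)) := by
    refine (hU.isModelMap hcomm h₁ h₂).norm_polyEval_le (Real.sSup_nonneg ?_)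
      fun z hz x => hnd.norm_polySum_symbol_le hz p x
    rintro _ ⟨z, -, rfl⟩
    exact norm_nonneg _
  refine ⟨U, hU, hnd.isAlgebraicDistinguishedVariety, fun p => (hle p).trans ?_,
    BCL.reducedVariety U (BCL.sndProj T₁ T₂), hW, hnd.bclVariety_eq, hle⟩
  -- A real `sSup` is monotone only for nonempty, bounded sets.
  exact csSup_le_csSup (BCL.bddAbove_evalAt_image p fun z hz => hz.1) (hW.1.image _)
    (Set.image_mono hnd.reducedVariety_subset)
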